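/- Let $p$ be a prime number and $e\ge 1$ an integer. Let $\mathcal C_{p,e}$ be the category whose objects are the complete discrete valuation rings $R$ of characteristic $0$ with perfect residue field of characteristic $p$ and absolute ramification index $e$ (that is, $\nu(p)=e$ for the normalized valuation $\nu$ of $R$), and whose morphisms are all ring homomorphisms. For an integer $n\ge 1$, let $\mathcal R_{p,e}^{n}$ be the category whose objects are the principal Artinian local rings $\overline R$ of length $n$ with perfect residue field of characteristic $p$ which, in the case $n>e$, also satisfy $p\in\overline{\mathfrak m}^{e}\setminus\overline{\mathfrak m}^{e+1}$, where $\overline{\mathfrak m}$ is the maximal ideal of $\overline R$; the morphisms are all ring homomorphisms. Let $\mathrm{Pr}_n:\mathcal C_{p,e}\to\mathcal R_{p,e}^{n}$ and, for $1\le n\le m$, $\mathrm{Pr}^m_n:\mathcal R_{p,e}^{m}\to\mathcal R_{p,e}^{n}$ be the projection functors which send a ring with maximal ideal $\mathfrak m$ to its quotient by $\mathfrak m^{n}$. The category $\mathcal C_{p,e}$ is called $n$-liftable if there is a functor $L:\mathcal R_{p,e}^{n}\to\mathcal C_{p,e}$ such that 1. $(\mathrm{Pr}_n\circ L)(\overline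 R)\cong\overline R$ for every object $\overline R$ of $\mathcal R_{p,e}^{n}$; 2. $\mathrm{Pr}_1\circ L$ is naturally isomorphic to $\mathrm{Pr}^{n}_1$; 3. $L\circ\mathrm{Pr}_n$ is naturally isomorphic to the identity functor $\mathrm{Id}_{\mathcal C_{p,e}}$. The lifting number for $\mathcal C_{p,e}$ is the smallest positive integer $n$ such that $\mathcal C_{p,e}$ is $n$-liftable, and it is $\infty$ if there is no such $n$. **Corollary.** Suppose that $p$ does not divide $e$ and that $e>1$. Then the lifting number for $\mathcal C_{p,e}$ is $e+1$. -/

import Mathlib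

open CategoryTheory IsLocalRing

universe u

namespace LiftingNumber

/-! ### Residue rings -/

/-- The `n`-th residue ring `R / 𝔪 ^ n` of a local ring `R`. -/
abbrev ResidueRing (R : Type u) [CommRing R] [IsLocalRing R] (n : ℕ) : Type u :=
  R ⧸ maximalIdeal R ^ n

/-- The map `R / 𝔪 ^ n → S / 𝔫 ^ n` induced by a ring homomorphism `f : R → S` of local rings
with `f(𝔪) ⊆ 𝔫`. -/
def residueRingMap {R S : Type u} [CommRing R] [IsLocalRing R] [CommRing S] [IsLocalRing S]
    (n : ℕ) (f : R →+* S) (hf : maximalIdeal R ≤ (maximalIdeal S).comap f) :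
    ResidueRing R n →+* ResidueRing S n :=
  Ideal.quotientMap (maximalIdeal S ^ n) f
    ((Ideal.pow_right_mono hf n).trans (Ideal.le_comap_pow f n))

/-! ### The two kinds of rings -/

/-- `R` is a complete discrete valuation ring of mixed characteristic `(0, p)` with perfect
residue field and absolute ramification index `e`, that is `ν(p) = e` for the normalized
valuation `ν` of `R`. -/
structure IsMixedCDVR (p e : ℕ) (R : Type u) [CommRing R] : Prop where
  [isDomain : IsDomain R]
  [isDiscreteValuationRing : IsDiscreteValuationRing R]
  isAdicComplete : IsAdicComplete (maximalIdeal R) R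
  charZero : CharZero R
  charP_residueField : CharP (ResidueField R) p
  perfectField_residueField : PerfectField (ResidueField R)
  addVal_eq : IsDiscreteValuationRing.addVal R (p : R) = (e : ℕ∞)

/-- `R` is a principal Artinian local ring of length `n` with perfect residue field of
characteristic `p` such that, in case `n > e`, `p ∈ 𝔪 ^ e \ 𝔪 ^ (e + 1)`. -/
structure IsPrincipalArtinLocal (p e n : ℕ) (R : Type u) [CommRing R] : Prop where
  [isLocalRing : IsLocalRing R]
  isPrincipalIdealRing : IsPrincipalIdealRing R
  isArtinianRing : IsArtinianRing R
  length_eq : Module.length R R = (n : ℕ∞)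
  charP_residueField : CharP (ResidueField R) p
  perfectField_residueField : PerfectField (ResidueField R)
  mem_and_notMem : e < n → (p : R) ∈ maximalIdeal R ^ e ∧ (p : R) ∉ maximalIdeal R ^ (e + 1)

/-! ### Facts needed to see that the projections are functors -/

section Facts

variable {R S : Type u} [CommRing R] [CommRing S]

lemma isLocalRing_residueRing [IsLocalRing R] {n : ℕ} (hn : 0 < n) :
    IsLocalRing (ResidueRing R n) := by
  have : Nontrivial (ResidueRing R n) := by
    refine Ideal.Quotient.nontrivial_iff.mpr fun h => ?_
    have h1 : maximalIdeal R ^ n ≤ maximalIdeal R := Ideal.pow_le_self hn.ne'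
    rw [h] at h1
    exact (maximalIdeal.isMaximal R).ne_top (top_le_iff.mp h1)
  exact IsLocalRing.of_surjective' _ Ideal.Quotient.mk_surjective

lemma maximalIdeal_residueRing [IsLocalRing R] {n : ℕ} [IsLocalRing (ResidueRing R n)] :
    maximalIdeal (ResidueRing R n) =
      (maximalIdeal R).map (Ideal.Quotient.mk (maximalIdeal R ^ n)) := by
  have hloc : IsLocalHom (Ideal.Quotient.mk (maximalIdeal R ^ n)) :=
    .of_surjective _ Ideal.Quotient.mk_surjective
  refine (le_antisymm ?_ ?_)
  · intro x hx
    obtain ⟨y, rfl⟩ := Ideal.Quotient.mk_surjective x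
    refine Ideal.mem_map_of_mem _ ?_
    rw [mem_maximalIdeal, mem_nonunits_iff] at hx ⊢
    exact fun h => hx (h.map _)
  · refine Ideal.map_le_iff_le_comap.mpr ?_
    intro x hx
    rw [Ideal.mem_comap, mem_maximalIdeal, mem_nonunits_iff]
    intro h
    exact hx (isUnit_of_map_unit _ _ h)

lemma mk_mem_pow_iff [IsLocalRing R] {n : ℕ} [IsLocalRing (ResidueRing R n)] {k : ℕ}
    (hk : k ≤ n) (x : R) :
    Ideal.Quotient.mk (maximalIdeal R ^ n) x ∈ maximalIdeal (ResidueRing R n) ^ k ↔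
      x ∈ maximalIdeal R ^ k := by
  rw [maximalIdeal_residueRing, ← Ideal.map_pow, Ideal.mem_map_iff_of_surjective _
    Ideal.Quotient.mk_surjective]
  constructor
  · rintro ⟨y, hy, hxy⟩
    have h := Ideal.pow_le_pow_right hk (Ideal.Quotient.eq.mp hxy)
    have := sub_mem hy h
    simpa using this
  · exact fun h => ⟨x, h, rfl⟩

lemma pow_eq_bot_of_pow_succ_eq [IsLocalRing R] [IsNoetherianRing R] {i : ℕ}
    (h : maximalIdeal R ^ (i + 1) = maximalIdeal R ^ i) : maximalIdeal R ^ i = ⊥ := by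
  refine Submodule.eq_bot_of_le_smul_of_le_jacobson_bot (maximalIdeal R) _
    (IsNoetherian.noetherian _) ?_ (maximalIdeal_le_jacobson ⊥)
  rw [smul_eq_mul, ← pow_succ', h]

lemma length_residueRing_aux [IsLocalRing R] [IsPrincipalIdealRing R] {n : ℕ}
    (h : ∀ i < n, maximalIdeal R ^ (i + 1) ≠ maximalIdeal R ^ i) :
    Module.length R (ResidueRing R n) = (n : ℕ∞) := by
  induction n with
  | zero =>
    rw [Nat.cast_zero, Module.length_eq_zero_iff]
    exact Ideal.Quotient.subsingleton_iff.mpr (by simp)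
  | succ n ih =>
    obtain ⟨t, ht⟩ := (IsPrincipalIdealRing.principal (maximalIdeal R)).principal
    have ht' : ∀ k, maximalIdeal R ^ k = Ideal.span {t ^ k} := fun k => by
      rw [ht]; exact Ideal.span_singleton_pow t k
    let f : (R ⧸ maximalIdeal R) →ₗ[R] ResidueRing R (n + 1) :=
      Submodule.mapQ (maximalIdeal R) (maximalIdeal R ^ (n + 1)) (LinearMap.mulLeft R (t ^ n)) (by
        intro x hx
        rw [Submodule.mem_comap, LinearMap.mulLeft_apply, pow_succ]
        exact Ideal.mul_mem_mul (by rw [ht']; exact Ideal.mem_span_singleton_self _) hx)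
    let g : ResidueRing R (n + 1) →ₗ[R] ResidueRing R n :=
      Submodule.factor (Ideal.pow_le_pow_right (Nat.le_succ n))
    have hf : Function.Injective f := by
      rw [← LinearMap.ker_eq_bot, LinearMap.ker_eq_bot']
      intro x hx
      obtain ⟨x, rfl⟩ := Submodule.Quotient.mk_surjective _ x
      rw [Submodule.mapQ_apply, Submodule.Quotient.mk_eq_zero, LinearMap.mulLeft_apply] at hx
      rw [Submodule.Quotient.mk_eq_zero]
      by_contra hu
      have hu' : IsUnit x := by
        rwa [mem_maximalIdeal, mem_nonunits_iff, not_not] at hu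
      refine h n (Nat.lt_succ_self n) (le_antisymm (Ideal.pow_le_pow_right (Nat.le_succ n)) ?_)
      rw [ht' n, Ideal.span_singleton_le_iff_mem]
      exact (Ideal.mul_unit_mem_iff_mem _ hu').mp hx
    have hg : Function.Surjective g := Submodule.factor_surjective _
    have hfg : Function.Exact f g := by
      intro y
      obtain ⟨y, rfl⟩ := Submodule.Quotient.mk_surjective _ y
      constructor
      · intro hy
        have hy' : y ∈ maximalIdeal R ^ n := (Submodule.Quotient.mk_eq_zero _).mp hy
        rw [ht', Ideal.mem_span_singleton] at hy'
        obtain ⟨z, rfl⟩ := hy'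
        exact ⟨Submodule.Quotient.mk z, rfl⟩
      · rintro ⟨z, hz⟩
        obtain ⟨z, rfl⟩ := Submodule.Quotient.mk_surjective _ z
        rw [← hz]
        refine (Submodule.Quotient.mk_eq_zero _).mpr ?_
        rw [LinearMap.mulLeft_apply, ht']
        exact Ideal.mul_mem_right _ _ (Ideal.mem_span_singleton_self _)
    have hs : IsSimpleModule R (R ⧸ maximalIdeal R) :=
      isSimpleModule_iff_isCoatom.mpr (maximalIdeal.isMaximal R).out
    rw [Module.length_eq_add_of_exact f g hf hg hfg, ih fun i hi => h i (hi.trans (Nat.lt_succ_self n)),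
      Module.length_eq_one]
    push_cast
    exact add_comm _ _

lemma pow_succ_ne_of_length [IsLocalRing R] [IsPrincipalIdealRing R] {m : ℕ}
    (h : Module.length R R = (m : ℕ∞)) {i : ℕ} (hi : i < m) :
    maximalIdeal R ^ (i + 1) ≠ maximalIdeal R ^ i := by
  intro hi'
  have hex : ∃ k, maximalIdeal R ^ k = ⊥ := ⟨i, pow_eq_bot_of_pow_succ_eq hi'⟩
  classical
  have hk := Nat.find_spec hex
  have hki : Nat.find hex ≤ i := Nat.find_min' hex (pow_eq_bot_of_pow_succ_eq hi')
  have hlen := length_residueRing_aux (R := R) (n := Nat.find hex) fun j hj hj' =>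
    Nat.find_min hex hj (pow_eq_bot_of_pow_succ_eq hj')
  rw [(Submodule.quotEquivOfEqBot _ hk).length_eq, h, Nat.cast_inj] at hlen
  omega

lemma isPrincipalArtinLocal_residueRing [IsLocalRing R] [IsPrincipalIdealRing R] {p e n : ℕ}
    (hn : 0 < n) (h : ∀ i < n, maximalIdeal R ^ (i + 1) ≠ maximalIdeal R ^ i)
    (hp : CharP (ResidueField R) p) (hk : PerfectField (ResidueField R))
    (he : e < n → (p : R) ∈ maximalIdeal R ^ e ∧ (p : R) ∉ maximalIdeal R ^ (e + 1)) :
    IsPrincipalArtinLocal p e n (ResidueRing R n) := by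
  have hloc := isLocalRing_residueRing (R := R) hn
  have hlen : Module.length (ResidueRing R n) (ResidueRing R n) = (n : ℕ∞) := by
    rw [← length_residueRing_aux h]
    exact (Module.length_eq_of_surjective (R := ResidueRing R n) (S := R)
      Ideal.Quotient.mk_surjective).symm
  have hhom : IsLocalHom (Ideal.Quotient.mk (maximalIdeal R ^ n)) :=
    .of_surjective _ Ideal.Quotient.mk_surjective
  let φ := ResidueField.map (Ideal.Quotient.mk (maximalIdeal R ^ n))
  have hφ : Function.Bijective φ := by
    refine ⟨φ.injective, fun x => ?_⟩
    obtain ⟨x, rfl⟩ := residue_surjective x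
    obtain ⟨x, rfl⟩ := Ideal.Quotient.mk_surjective x
    exact ⟨residue R x, ResidueField.map_residue _ _⟩
  refine
    { isPrincipalIdealRing := .of_surjective _ Ideal.Quotient.mk_surjective
      isArtinianRing := ?_
      length_eq := hlen
      charP_residueField := charP_of_injective_ringHom φ.injective p
      perfectField_residueField := .of_ringEquiv (RingEquiv.ofBijective φ hφ)
      mem_and_notMem := fun hen => ?_ }
  · have : IsFiniteLength (ResidueRing R n) (ResidueRing R n) :=
      Module.length_ne_top_iff.mp (by rw [hlen]; exact ENat.natCast_ne_top n)
    exact (isFiniteLength_iff_isNoetherian_isArtinian.mp this).2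
  · have := he hen
    rwa [← mk_mem_pow_iff hen.le, ← mk_mem_pow_iff (n := n) (Nat.succ_le_of_lt hen),
      map_natCast] at this

lemma IsPrincipalArtinLocal.residueRing {p e m n : ℕ} [IsLocalRing R] (hn : 0 < n) (hnm : n ≤ m)
    (h : IsPrincipalArtinLocal p e m R) : IsPrincipalArtinLocal p e n (ResidueRing R n) := by
  have := h.isPrincipalIdealRing
  exact isPrincipalArtinLocal_residueRing hn
    (fun i hi => pow_succ_ne_of_length h.length_eq (hi.trans_le hnm)) h.charP_residueField
    h.perfectField_residueField fun he => h.mem_and_notMem (he.trans_le hnm)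

lemma IsMixedCDVR.mem_pow_iff {p e : ℕ} [IsLocalRing R] (h : IsMixedCDVR p e R) (k : ℕ) :
    (p : R) ∈ maximalIdeal R ^ k ↔ k ≤ e := by
  have := h.isDomain
  have := h.isDiscreteValuationRing
  obtain ⟨t, ht⟩ := IsDiscreteValuationRing.exists_irreducible R
  rw [ht.maximalIdeal_eq, Ideal.span_singleton_pow, Ideal.mem_span_singleton,
    ← IsDiscreteValuationRing.addVal_le_iff_dvd, h.addVal_eq, ht.addVal_pow, Nat.cast_le]

lemma IsMixedCDVR.residueRing {p e n : ℕ} [IsLocalRing R] (hn : 0 < n)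
    (h : IsMixedCDVR p e R) : IsPrincipalArtinLocal p e n (ResidueRing R n) := by
  have := h.isDomain
  have := h.isDiscreteValuationRing
  refine isPrincipalArtinLocal_residueRing hn (fun i _ hi => ?_) h.charP_residueField
    h.perfectField_residueField fun _ => by simp [h.mem_pow_iff]
  exact pow_ne_zero i (IsDiscreteValuationRing.not_a_field R) (pow_eq_bot_of_pow_succ_eq hi)

lemma IsMixedCDVR.maximalIdeal_le_comap {p e : ℕ} [IsLocalRing R] [IsLocalRing S]
    (hR : IsMixedCDVR p e R) (hS : IsMixedCDVR p e S) (f : R →+* S) :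
    maximalIdeal R ≤ (maximalIdeal S).comap f := by
  have := hR.isDomain
  have := hR.isDiscreteValuationRing
  intro x hx
  have hpS : (p : S) ∈ maximalIdeal S := by
    rw [← residue_eq_zero_iff, map_natCast]
    have := hS.charP_residueField
    exact CharP.cast_eq_zero _ p
  have hdvd : (p : R) ∣ x ^ e := by
    obtain ⟨t, ht⟩ := IsDiscreteValuationRing.exists_irreducible R
    have htx : t ∣ x := by
      rwa [ht.maximalIdeal_eq, Ideal.mem_span_singleton] at hx
    refine dvd_trans ?_ (pow_dvd_pow_of_dvd htx e)
    rw [← IsDiscreteValuationRing.addVal_le_iff_dvd, hR.addVal_eq, ht.addVal_pow]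
  have hmem : f x ^ e ∈ maximalIdeal S := by
    rw [← map_pow]
    refine Ideal.mem_of_dvd _ ?_ hpS
    simpa using map_dvd f hdvd
  exact (maximalIdeal.isMaximal S).isPrime.mem_of_pow_mem _ hmem

lemma IsPrincipalArtinLocal.maximalIdeal_le_comap {p e n : ℕ} [IsLocalRing R] [IsLocalRing S]
    (hR : IsPrincipalArtinLocal p e n R) (f : R →+* S) :
    maximalIdeal R ≤ (maximalIdeal S).comap f := by
  have := hR.isArtinianRing
  intro x hx
  have hnil : IsNilpotent x := by
    rw [← mem_nilradical]
    obtain ⟨k, hk⟩ := IsArtinianRing.isNilpotent_jacobson_bot (R := R)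
    refine ⟨k, ?_⟩
    have : x ^ k ∈ (Ideal.jacobson (⊥ : Ideal R)) ^ k :=
      Ideal.pow_mem_pow (maximalIdeal_le_jacobson ⊥ hx) k
    rw [hk] at this
    exact this
  rw [Ideal.mem_comap, mem_maximalIdeal, mem_nonunits_iff]
  exact fun h => (hnil.map f).not_isUnit h

end Facts

/-! ### The categories and the projection functors -/

/-- The category `𝒞_{p,e}` of complete discrete valuation rings of mixed characteristic `(0, p)`
with perfect residue field and ramification index `e`, with all ring homomorphisms. -/
abbrev CatC (p e : ℕ) : Type (u + 1) :=
  ObjectProperty.FullSubcategory fun R : CommRingCat.{u} => IsMixedCDVR p e R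

/-- The category `ℛ_{p,e}^n` of principal Artinian local rings of length `n` with perfect residue
field of characteristic `p`, and with `p ∈ 𝔪 ^ e \ 𝔪 ^ (e + 1)` if `n > e`, with all ring
homomorphisms. -/
abbrev CatR (p e n : ℕ) : Type (u + 1) :=
  ObjectProperty.FullSubcategory fun R : CommRingCat.{u} => IsPrincipalArtinLocal p e n R

instance {p e : ℕ} (R : CatC.{u} p e) : IsLocalRing R.obj :=
  haveI := R.property.isDomain
  haveI := R.property.isDiscreteValuationRing
  inferInstance

instance {p e n : ℕ} (R : CatR.{u} p e n) : IsLocalRing R.obj :=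
  R.property.isLocalRing

/-- The canonical projection functor `Pr_n : 𝒞_{p,e} ⥤ ℛ_{p,e}^n`, `R ↦ R / 𝔪 ^ n`. -/
def Pr (p e : ℕ) {n : ℕ} (hn : 0 < n) : CatC.{u} p e ⥤ CatR.{u} p e n where
  obj R := ⟨CommRingCat.of (ResidueRing R.obj n), R.property.residueRing hn⟩
  map {R S} f := ObjectProperty.homMk <| CommRingCat.ofHom <|
    residueRingMap n f.hom.hom (R.property.maximalIdeal_le_comap S.property f.hom.hom)
  map_id R := by
    ext x
    rfl
  map_comp f g := by
    ext x
    rfl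

/-- The canonical projection functor `Pr^m_n : ℛ_{p,e}^m ⥤ ℛ_{p,e}^n`, `R ↦ R / 𝔪 ^ n`,
for `0 < n ≤ m`. -/
def PrR (p e : ℕ) {m n : ℕ} (hn : 0 < n) (hnm : n ≤ m) : CatR.{u} p e m ⥤ CatR.{u} p e n where
  obj R := ⟨CommRingCat.of (ResidueRing R.obj n), R.property.residueRing hn hnm⟩
  map {R S} f := ObjectProperty.homMk <| CommRingCat.ofHom <|
    residueRingMap n f.hom.hom (R.property.maximalIdeal_le_comap f.hom.hom)
  map_id R := by
    ext x
    rfl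
  map_comp f g := by
    ext x
    rfl

/-! ### Lifting functors and the lifting number -/

/-- `L : ℛ_{p,e}^n ⥤ 𝒞_{p,e}` is an `n`-th lifting functor of `𝒞_{p,e}` (`n ≥ 1`). -/
structure IsLiftingFunctor (p e : ℕ) {n : ℕ} (hn : 0 < n) (L : CatR.{u} p e n ⥤ CatC.{u} p e) :
    Prop where
  residueRing_iso : ∀ R : CatR.{u} p e n, Nonempty ((Pr p e hn).obj (L.obj R) ≅ R)
  residueField_iso : Nonempty (L ⋙ Pr p e one_pos ≅ PrR p e one_pos (Nat.succ_le_of_lt hn))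
  id_iso : Nonempty (Pr p e hn ⋙ L ≅ 𝟭 (CatC.{u} p e))

/-- `𝒞_{p,e}` is `n`-liftable. -/
def IsLiftable (p e n : ℕ) : Prop :=
  ∃ (hn : 0 < n) (L : CatR.{u} p e n ⥤ CatC.{u} p e), IsLiftingFunctor p e hn L

/-- The lifting number for `𝒞_{p,e}`: the smallest positive integer `n` such that `𝒞_{p,e}` is
`n`-liftable, and `∞` if there is no such `n`. -/
noncomputable def liftingNumber (p e : ℕ) : ℕ∞ :=
  ⨅ (n : ℕ) (_ : IsLiftable.{u} p e n), (n : ℕ∞)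

end LiftingNumber

/-! Write `T_u = W(k)[X]/(X^e - [u]p)` for a nonzero `u` in a perfect field `k` of characteristic
`p` (this is `TameRing`). Because `e` is a unit, Hensel's lemma lets a uniformizer be rescaled so
that its `e`-th power is exactly `[u]p`. Hence every object of `𝒞_{p,e}` is some `T_u` over its
residue field (`IsMixedCDVR.exists_tameRing_equiv`), and every object of `ℛ_{p,e}^{e+1}` is the
`(e+1)`-st residue ring of some `T_u` (`IsPrincipalArtinLocal.exists_lift`).

Upper bound. A homomorphism out of `T_u` is a homomorphism out of `W(k)` together with an `e`-th
root of the image of `[u]p`. The first lifts uniquely from residue fields. A root modulo `𝔪^(e+1)`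
becomes, after division by the `e`-th power of a uniformizer, an `e`-th root of a unit modulo `𝔪`,
which Hensel makes exact. The resulting lift agrees with the given map only modulo `𝔪^2`
(`IsMixedCDVR.exists_hom`), but that congruence already determines it (`IsMixedCDVR.hom_ext`).
Uniqueness makes the lifts functorial (`exists_functor_of_existsUnique_lift`).

Lower bound. If `n ≤ e`, then `p = 0` in the `n`-th residue ring, so that ring does not see `u`
(`TameRing.nonempty_residueRing_equiv`). An `n`-th lifting functor would give `T_u ≅ T_1`, which
forces `u` to be an `e`-th power; a suitable finite field has a `u` that is not. -/

namespace LiftingNumber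

/-! ### Homomorphisms out of Witt vectors of a perfect ring -/

section WittLift

open WittVector

variable {p : ℕ} [Fact p.Prime] {k S : Type*} [CommRing k] [CommRing S] {I : Ideal S}

/-- The terms of the ghost component are `p^i * x_i^(p^(n-i))`, of order at least `i + p^(n-i)` in
`I`, and `p^m > m`. -/
lemma ghostComponent_mem_pow (hp : (p : S) ∈ I) {x : WittVector p S} (hx : ∀ i, x.coeff i ∈ I)
    (n : ℕ) : WittVector.ghostComponent n x ∈ I ^ (n + 1) := by
  rw [WittVector.ghostComponent_apply, wittPolynomial_eq_sum_C_mul_X_pow, map_sum]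
  refine Ideal.sum_mem _ fun i hi => ?_
  have hi : i ≤ n := Nat.lt_succ_iff.mp (Finset.mem_range.mp hi)
  simp only [map_mul, map_pow, map_natCast, MvPolynomial.aeval_X]
  have h1 : n + 1 ≤ i + p ^ (n - i) := by
    have := Nat.lt_pow_self (n := n - i) (Fact.out : p.Prime).one_lt
    omega
  refine Ideal.pow_le_pow_right h1 ?_
  rw [pow_add]
  exact Ideal.mul_mem_mul (Ideal.pow_mem_pow hp _) (Ideal.pow_mem_pow (hx i) _)

/-- The ring homomorphism `𝕎 (S / I) → S / I ^ (n + 1)` induced by the `n`-th ghost component. -/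
noncomputable def ghostModPow (hp : (p : S) ∈ I) (n : ℕ) :
    WittVector p (S ⧸ I) →+* S ⧸ I ^ (n + 1) :=
  RingHom.liftOfSurjective (WittVector.map (Ideal.Quotient.mk I))
    (map_surjective _ Ideal.Quotient.mk_surjective)
    ⟨(Ideal.Quotient.mk (I ^ (n + 1))).comp (WittVector.ghostComponent n), fun x hx => by
      rw [RingHom.mem_ker, RingHom.comp_apply, Ideal.Quotient.eq_zero_iff_mem]
      refine ghostComponent_mem_pow hp (fun i => ?_) n
      have := congrArg (fun y => y.coeff i) (RingHom.mem_ker.mp hx)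
      simpa [Ideal.Quotient.eq_zero_iff_mem] using this⟩

lemma ghostModPow_map (hp : (p : S) ∈ I) (n : ℕ) (x : WittVector p S) :
    ghostModPow hp n (WittVector.map (Ideal.Quotient.mk I) x) =
      Ideal.Quotient.mk _ (WittVector.ghostComponent n x) :=
  RingHom.liftOfSurjective_comp_apply ..

lemma ghostModPow_teichmuller (hp : (p : S) ∈ I) (n : ℕ) (y : S) :
    ghostModPow hp n (teichmuller p (Ideal.Quotient.mk I y)) = Ideal.Quotient.mk _ (y ^ p ^ n) := by
  rw [← WittVector.map_teichmuller, ghostModPow_map, ghostComponent_teichmuller]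

variable [CharP k p] [PerfectRing k p]

/-- Ring homomorphisms out of `𝕎 k` into an `I`-adically separated ring are determined by their
reductions modulo `I`. -/
lemma wittVector_hom_ext [IsHausdorff I S] (hp : (p : S) ∈ I) {g g' : WittVector p k →+* S}
    (h : ∀ x, g x - g' x ∈ I) : g = g' := by
  have key : ∀ n : ℕ, (Ideal.Quotient.mk (I ^ (n + 1))).comp g =
      (Ideal.Quotient.mk (I ^ (n + 1))).comp g' := by
    intro n
    -- Since `p` is nilpotent modulo `I^(n+1)`, only Teichmüller elements matter. Writing such an
    -- element as a `p^n`-th power improves a congruence modulo `I` to one modulo `I^(n+1)`.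
    refine eq_of_apply_teichmuller_eq _ _ ⟨n + 1, ?_⟩ fun x => ?_
    · rw [← map_natCast (Ideal.Quotient.mk (I ^ (n + 1))), ← map_pow,
        Ideal.Quotient.eq_zero_iff_mem]
      exact Ideal.pow_mem_pow hp _
    · obtain ⟨y, rfl⟩ := (iterateFrobeniusEquiv k p n).surjective x
      rw [iterateFrobeniusEquiv_def, map_pow, RingHom.comp_apply, RingHom.comp_apply, map_pow g,
        map_pow g']
      have := SModEq.pow_pow_add_one hp (x := g (teichmuller p y)) (y := g' (teichmuller p y))
        (SModEq.sub_mem.mpr (h _)) n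
      exact Ideal.Quotient.eq.mpr (SModEq.sub_mem.mp this)
  ext x
  rw [← sub_eq_zero]
  refine IsHausdorff.haus (I := I) inferInstance _ fun n => ?_
  rw [SModEq.zero, smul_eq_mul, Ideal.mul_top]
  refine Ideal.pow_le_pow_right n.le_succ (Ideal.Quotient.eq.mp ?_)
  exact DFunLike.congr_fun (key n) x

/-- A ring homomorphism `k → S / I` lifts to `𝕎 k → S` if `S` is `I`-adically complete. -/
lemma exists_wittVector_lift [IsAdicComplete I S] (hp : (p : S) ∈ I) (σ : k →+* S ⧸ I) :
    ∃ g : WittVector p k →+* S, ∀ x, Ideal.Quotient.mk I (g x) = σ (x.coeff 0) := by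
  -- The `n`-th ghost component raises Teichmüller representatives to the power `p^n`. The inverse
  -- Frobenius twist undoes this on residues, so the maps `f n` are compatible and all reduce to
  -- `σ`.
  let f (n : ℕ) : WittVector p k →+* S ⧸ I ^ (n + 1) :=
    ((ghostModPow hp n).comp (WittVector.map σ)).comp
      (WittVector.map (((iterateFrobeniusEquiv k p n).symm : k ≃+* k) : k →+* k))
  have hft (n : ℕ) (x : k) (y : S)
      (hy : Ideal.Quotient.mk I y = σ ((iterateFrobeniusEquiv k p n).symm x)) :
      f n (teichmuller p x) = Ideal.Quotient.mk _ (y ^ p ^ n) := by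
    simp only [f, RingHom.comp_apply, WittVector.map_teichmuller]
    rw [← ghostModPow_teichmuller hp, hy]
    rfl
  have hf (n : ℕ) : (Ideal.Quotient.factorPow I (Nat.succ_le_succ n.le_succ)).comp (f (n + 1)) =
      f n := by
    refine eq_of_apply_teichmuller_eq _ _ ⟨n + 1, ?_⟩ fun x => ?_
    · rw [← map_natCast (Ideal.Quotient.mk (I ^ (n + 1))), ← map_pow,
        Ideal.Quotient.eq_zero_iff_mem]
      exact Ideal.pow_mem_pow hp _
    · obtain ⟨y, hy⟩ := Ideal.Quotient.mk_surjective (σ ((iterateFrobeniusEquiv k p (n + 1)).symm x))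
      rw [RingHom.comp_apply, hft (n + 1) x y hy, hft n x (y ^ p), ← pow_mul, ← pow_succ']
      · rfl
      · rw [map_pow, hy, ← map_pow]
        congr 1
        apply (iterateFrobeniusEquiv k p n).injective
        rw [RingEquiv.apply_symm_apply, iterateFrobeniusEquiv_def, ← pow_mul, ← pow_succ',
          ← iterateFrobeniusEquiv_def, RingEquiv.apply_symm_apply]
  let g := IsAdicComplete.StrictMono.liftRingHom I Order.succ_strictMono f (hf _)
  refine ⟨g, fun x => ?_⟩
  have h0 : Ideal.Quotient.mk (I ^ (0 + 1)) (g x) = f 0 x :=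
    IsAdicComplete.StrictMono.mk_liftRingHom I Order.succ_strictMono f (hf _) x
  obtain ⟨y, hy⟩ := map_surjective _ Ideal.Quotient.mk_surjective (WittVector.map σ x)
  have h1 : f 0 x = Ideal.Quotient.mk (I ^ (0 + 1)) (y.coeff 0) := by
    have : WittVector.map (((iterateFrobeniusEquiv k p 0).symm : k ≃+* k) : k →+* k) x = x := by
      ext i
      rw [WittVector.map_coeff]
      apply (iterateFrobeniusEquiv k p 0).injective
      simp
    simp only [f, RingHom.comp_apply, this]
    rw [← hy, ghostModPow_map, ghostComponent_apply]
    simp [wittPolynomial_eq_sum_C_mul_X_pow]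
  rw [h1, Ideal.Quotient.eq, zero_add, pow_one, ← Ideal.Quotient.eq] at h0
  rw [h0, ← WittVector.map_coeff, hy, WittVector.map_coeff]

end WittLift

/-! ### Adic completeness and Hensel's lemma for `e`-th roots -/

section Complete

variable {R : Type*} [CommRing R]

lemma isAdicComplete_of_basis (I : Ideal R) [IsAdicComplete I R] {M : Type*} [AddCommGroup M]
    [Module R M] {n : ℕ} (b : Module.Basis (Fin n) R M) : IsAdicComplete I M := by
  have hpi : Function.Bijective (AdicCompletion.of I (Fin n → R)) := by
    have h : (AdicCompletion.piEquivFin I n) ∘ (AdicCompletion.of I (Fin n → R)) =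
        fun x i => AdicCompletion.of I R (x i) := by
      ext x i
      simp [AdicCompletion.piEquivFin_apply, AdicCompletion.pi]
      rfl
    rw [← Function.Bijective.of_comp_iff' (AdicCompletion.piEquivFin I n).bijective, h]
    exact Function.Bijective.piMap fun _ => AdicCompletion.of_bijective I R
  rw [← AdicCompletion.of_bijective_iff]
  have h : (AdicCompletion.congr I b.equivFun) ∘ (AdicCompletion.of I M) =
      AdicCompletion.of I (Fin n → R) ∘ b.equivFun := by
    ext x
    simp
  rw [← Function.Bijective.of_comp_iff' (AdicCompletion.congr I b.equivFun).bijective, h]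
  exact hpi.comp b.equivFun.bijective

/-- The ideals `I` and `I ^ n` define the same topology. -/
lemma isAdicComplete_of_pow (I : Ideal R) {n : ℕ} (hn : 0 < n) [h : IsAdicComplete (I ^ n) R] :
    IsAdicComplete I R := by
  let : WithIdeal R := ⟨I⟩
  have h1 : IsAdic I := rfl
  rw [h1.isAdicComplete_iff]
  exact (is_ideal_adic_pow h1 hn).isAdicComplete_iff.mp h

/-- Hensel's lemma for the equation `w ^ e = a`. -/
lemma exists_pow_eq [IsLocalRing R] [IsAdicComplete (maximalIdeal R) R] {e : ℕ} (he : 0 < e)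
    (hu : IsUnit (e : R)) {a z : R} (hz : IsUnit z) (h : z ^ e - a ∈ maximalIdeal R) :
    ∃ w, w ^ e = a ∧ w - z ∈ maximalIdeal R := by
  obtain ⟨w, hw, hwz⟩ := HenselianRing.is_henselian (I := maximalIdeal R)
    (Polynomial.X ^ e - Polynomial.C a) (Polynomial.monic_X_pow_sub_C a he.ne') z (by simpa using h)
    (by
      refine IsUnit.map _ ?_
      simpa [Polynomial.derivative_X_pow] using hu.mul (hz.pow (e - 1)))
  refine ⟨w, ?_, hwz⟩
  simpa [Polynomial.IsRoot, sub_eq_zero] using hw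

/-- Two `e`-th roots of the same element which agree to higher order are equal. -/
lemma eq_of_pow_eq [IsDomain R] [IsLocalRing R] {e : ℕ} (hu : IsUnit (e : R)) {y v : R}
    (hy : y ≠ 0) (hv : v - 1 ∈ maximalIdeal R) (h : (y * v) ^ e = y ^ e) : v = 1 := by
  have h1 : v ^ e = 1 := by
    rw [mul_pow] at h
    exact mul_left_cancel₀ (pow_ne_zero e hy) (by rw [h, mul_one])
  have h2 := mul_geom_sum v e
  rw [h1, sub_self] at h2
  rcases mul_eq_zero.mp h2 with h3 | h3
  · exact sub_eq_zero.mp h3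
  -- Modulo `𝔪` every power of `v` is `1`, so the geometric sum reduces to `e`, which is a unit.
  · exfalso
    have hv' : residue R v = 1 := by
      rw [← sub_eq_zero, ← map_one (residue R), ← map_sub, residue_eq_zero_iff]
      exact hv
    have := congrArg (residue R) h3
    rw [map_sum] at this
    simp only [map_pow, hv', one_pow, Finset.sum_const, Finset.card_range, nsmul_eq_mul, mul_one,
      map_zero] at this
    have h4 := hu.map (residue R)
    rw [map_natCast] at h4
    exact h4.ne_zero this

/-- A homomorphism of local rings inducing surjections on residue fields and maximal ideals is
surjective if the source is complete. -/
lemma surjective_of_isAdicComplete {S : Type*} [CommRing S] [IsLocalRing R] [IsLocalRing S]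
    [IsAdicComplete (maximalIdeal R) R] [IsHausdorff (maximalIdeal S) S] (φ : R →+* S)
    (hφ : (maximalIdeal R).map φ = maximalIdeal S)
    (h : ∀ y, ∃ x, y - φ x ∈ maximalIdeal S) : Function.Surjective φ := by
  have : IsHausdorff ((maximalIdeal R).map φ) S := by rw [hφ]; infer_instance
  refine surjective_of_mk_map_comp_surjective (I := maximalIdeal R) φ fun y => ?_
  obtain ⟨y, rfl⟩ := Ideal.Quotient.mk_surjective y
  obtain ⟨x, hx⟩ := h y
  refine ⟨x, (Ideal.Quotient.eq.mpr ?_).symm⟩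
  rwa [hφ]

end Complete

/-! ### The rings `W(k)[X]/(X^e - [u]p)` as objects of `𝒞_{p,e}` -/

section TameRing

open Polynomial WittVector

variable (p : ℕ) [hp : Fact p.Prime] {k : Type u} [Field k] (e : ℕ)

/-- The polynomial `X ^ e - [u] p` over the Witt vectors of `k`. -/
noncomputable def tamePoly (u : k) : (WittVector p k)[X] :=
  X ^ e - C (teichmuller p u * p)

/-- The totally and (if `p ∤ e`) tamely ramified extension of the Witt vectors of `k` obtained by
adjoining an `e`-th root of `[u] p`. -/
abbrev TameRing (u : k) : Type u := AdjoinRoot (tamePoly p e u)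

namespace TameRing

variable {p e}
variable {u : k}

lemma eval₂_tamePoly {S : Type*} [CommRing S] (g : WittVector p k →+* S) (y : S) :
    (tamePoly p e u).eval₂ g y = y ^ e - g (teichmuller p u) * p := by
  rw [tamePoly, eval₂_sub, eval₂_X_pow, eval₂_C, map_mul, map_natCast]

lemma root_pow : AdjoinRoot.root (tamePoly p e u) ^ e =
    AdjoinRoot.of (tamePoly p e u) (teichmuller p u) * p :=
  sub_eq_zero.mp ((eval₂_tamePoly _ _).symm.trans (AdjoinRoot.eval₂_root (tamePoly p e u)))

/-- The homomorphism given by a homomorphism on Witt vectors and an `e`-th root of the image of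
`[u] p`. -/
noncomputable def lift {S : Type*} [CommRing S] (g : WittVector p k →+* S) (y : S)
    (h : y ^ e = g (teichmuller p u) * p) : TameRing p e u →+* S :=
  AdjoinRoot.lift g y (by rw [eval₂_tamePoly, h, sub_self])

section Lift

variable {S : Type*} [CommRing S] (g : WittVector p k →+* S) (y : S)
    (h : y ^ e = g (teichmuller p u) * p)

@[simp]
lemma lift_root : lift g y h (AdjoinRoot.root _) = y := AdjoinRoot.lift_root _

@[simp]
lemma lift_of (x : WittVector p k) : lift g y h (AdjoinRoot.of _ x) = g x := AdjoinRoot.lift_of _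

end Lift

lemma natCast_mem_span_root (he : 0 < e) (hu : u ≠ 0) :
    (p : TameRing p e u) ∈ Ideal.span {AdjoinRoot.root (tamePoly p e u)} := by
  have h1 : IsUnit (AdjoinRoot.of (tamePoly p e u) (teichmuller p u)) :=
    ((isUnit_iff_ne_zero.mpr hu).map (teichmuller p)).map _
  rw [Ideal.mem_span_singleton, ← h1.dvd_mul_left, ← root_pow]
  exact dvd_pow_self _ he.ne'

variable [CharP k p]

/-- The projection of the tame ring to its residue field. -/
noncomputable def toField (he : 0 < e) : TameRing p e u →+* k :=
  lift WittVector.constantCoeff 0 (by simp [zero_pow he.ne'])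

lemma toField_surjective (he : 0 < e) : Function.Surjective (toField he : TameRing p e u →+* k) := fun x =>
  ⟨AdjoinRoot.of _ (teichmuller p x), by simp [toField, WittVector.constantCoeff]⟩

lemma of_injective (he : 0 < e) : Function.Injective (AdjoinRoot.of (tamePoly p e u)) :=
  AdjoinRoot.of.injective_of_degree_ne_zero (by
    rw [tamePoly, degree_X_pow_sub_C he]
    exact_mod_cast he.ne')

variable [PerfectRing k p]

/-- The root divides `p`, so modulo the root a polynomial is its constant coefficient in `W(k)`
taken modulo `p`. -/
lemma ker_toField (he : 0 < e) (hu : u ≠ 0) :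
    RingHom.ker (toField he : TameRing p e u →+* k) = Ideal.span {AdjoinRoot.root _} := by
  apply le_antisymm
  · intro x hx
    obtain ⟨f, rfl⟩ := AdjoinRoot.mk_surjective x
    rw [← X_mul_divX_add f] at hx ⊢
    rw [map_add, map_mul, AdjoinRoot.mk_X]
    refine Ideal.add_mem _ (Ideal.mul_mem_right _ _ (Ideal.mem_span_singleton_self _)) ?_
    have h1 : WittVector.constantCoeff (f.coeff 0) = 0 := by
      have h2 := RingHom.mem_ker.mp hx
      rw [map_add, map_mul, map_add, map_mul, AdjoinRoot.mk_X, AdjoinRoot.mk_C] at h2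
      simpa only [toField, lift_root, zero_mul, zero_add, lift_of] using h2
    rw [← RingHom.mem_ker, WittVector.ker_constantCoeff, Ideal.mem_span_singleton] at h1
    obtain ⟨c, hc⟩ := h1
    rw [hc, AdjoinRoot.mk_C, map_mul, map_natCast]
    exact Ideal.mul_mem_right _ _ (natCast_mem_span_root he hu)
  · rw [Ideal.span_singleton_le_iff_mem, RingHom.mem_ker, toField, lift_root]

lemma isMaximal_span_root (he : 0 < e) (hu : u ≠ 0) :
    (Ideal.span {AdjoinRoot.root (tamePoly p e u)}).IsMaximal := by
  rw [← ker_toField he hu]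
  exact RingHom.ker_isMaximal_of_surjective _ (toField_surjective he)

/-- The ring is finite free over the `p`-adically complete ring `W(k)`, and `p` generates the `e`-th
power of the ideal of the root. -/
lemma isAdicComplete_span_root (he : 0 < e) (hu : u ≠ 0) :
    IsAdicComplete (Ideal.span {AdjoinRoot.root (tamePoly p e u)}) (TameRing p e u) := by
  have h1 : IsAdicComplete (Ideal.span {(p : WittVector p k)}) (TameRing p e u) :=
    isAdicComplete_of_basis _ (AdjoinRoot.powerBasis' (monic_X_pow_sub_C _ he.ne')).basis
  rw [← IsAdicComplete.map_algebraMap_iff (S := TameRing p e u), Ideal.map_span,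
    Set.image_singleton, map_natCast] at h1
  have h2 : Ideal.span {(p : TameRing p e u)} = Ideal.span {AdjoinRoot.root (tamePoly p e u)} ^ e := by
    rw [Ideal.span_singleton_pow, root_pow, Ideal.span_singleton_mul_left_unit]
    exact ((isUnit_iff_ne_zero.mpr hu).map (teichmuller p)).map _
  rw [h2] at h1
  exact isAdicComplete_of_pow _ he

lemma isLocalRing (he : 0 < e) (hu : u ≠ 0) : IsLocalRing (TameRing p e u) :=
  have := isMaximal_span_root he hu
  have := isAdicComplete_span_root he hu
  isLocalRing_of_isAdicComplete_maximal (Ideal.span {AdjoinRoot.root (tamePoly p e u)})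

lemma maximalIdeal_eq (he : 0 < e) [IsLocalRing (TameRing p e u)] (hu : u ≠ 0) :
    maximalIdeal (TameRing p e u) = Ideal.span {AdjoinRoot.root _} :=
  (IsLocalRing.eq_maximalIdeal (isMaximal_span_root he hu)).symm

/-- The polynomial is Eisenstein at `p`: its constant term is a unit times `p`. -/
lemma prime_tamePoly (he : 0 < e) (hu : u ≠ 0) : Prime (tamePoly p e u) := by
  have hm : (tamePoly p e u).Monic := monic_X_pow_sub_C _ he.ne'
  have hd : (tamePoly p e u).natDegree = e := natDegree_X_pow_sub_C
  have hpr : Prime (p : WittVector p k) := (WittVector.irreducible p).prime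
  have hP : (Ideal.span {(p : WittVector p k)}).IsPrime :=
    (Ideal.span_singleton_prime hpr.ne_zero).mpr hpr
  have hU : IsUnit (teichmuller p u) := (isUnit_iff_ne_zero.mpr hu).map (teichmuller p)
  refine Irreducible.prime (IsEisensteinAt.irreducible (𝓟 := Ideal.span {(p : WittVector p k)})
    ?_ hP hm.isPrimitive (by rwa [hd]))
  refine hm.isEisensteinAt_of_mem_of_notMem hP.ne_top (fun {n} hn => ?_) ?_
  · rw [hd] at hn
    rw [tamePoly, coeff_sub, coeff_X_pow, if_neg hn.ne, zero_sub, coeff_C]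
    refine neg_mem ?_
    split_ifs
    · exact Ideal.mul_mem_left _ _ (Ideal.mem_span_singleton_self _)
    · exact zero_mem _
  · rw [tamePoly, coeff_sub, coeff_X_pow, if_neg he.ne, zero_sub, coeff_C_zero, neg_mem_iff,
      Ideal.span_singleton_pow, Ideal.mem_span_singleton, hU.dvd_mul_left, sq]
    rintro ⟨c, hc⟩
    rw [mul_assoc, eq_comm, mul_right_eq_self₀] at hc
    exact hc.elim (fun h => hpr.not_isUnit (.of_mul_eq_one _ h)) hpr.ne_zero

lemma isDomain (he : 0 < e) (hu : u ≠ 0) : IsDomain (TameRing p e u) :=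
  AdjoinRoot.isDomain_of_prime (prime_tamePoly he hu)

/-- A prime characteristic would be that of `k`, namely `p`, but `p` is nonzero in `W(k)`, which
embeds. -/
lemma charZero (he : 0 < e) (hu : u ≠ 0) : CharZero (TameRing p e u) := by
  have := isDomain he hu
  have h0 : (p : TameRing p e u) ≠ 0 := by
    rw [← map_natCast (AdjoinRoot.of (tamePoly p e u)), Ne,
      map_eq_zero_iff _ (of_injective he)]
    exact (WittVector.irreducible p).ne_zero
  obtain ⟨q, hq⟩ := CharP.exists (TameRing p e u)
  rcases CharP.char_is_prime_or_zero (TameRing p e u) q with hq' | rfl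
  · have h1 : (q : k) = 0 := by
      rw [← map_natCast (toField he : TameRing p e u →+* k), CharP.cast_eq_zero, map_zero]
    rw [CharP.cast_eq_zero_iff k p, Nat.prime_dvd_prime_iff_eq hp.out hq'] at h1
    subst h1
    exact absurd (CharP.cast_eq_zero _ _) h0
  · exact CharP.charP_to_charZero _

lemma root_ne_zero (he : 0 < e) (hu : u ≠ 0) : AdjoinRoot.root (tamePoly p e u) ≠ 0 := by
  have := charZero he hu
  intro h
  have h1 := root_pow (p := p) (e := e) (u := u)
  have h2 : IsUnit (AdjoinRoot.of (tamePoly p e u) (teichmuller p u)) :=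
    ((isUnit_iff_ne_zero.mpr hu).map (teichmuller p)).map _
  rw [h, zero_pow he.ne', eq_comm, h2.mul_right_eq_zero] at h1
  exact hp.out.ne_zero (Nat.cast_eq_zero.mp h1)

lemma irreducible_root (he : 0 < e) (hu : u ≠ 0) : Irreducible (AdjoinRoot.root (tamePoly p e u)) := by
  have := isDomain he hu
  exact ((Ideal.span_singleton_prime (root_ne_zero he hu)).mp
    (isMaximal_span_root he hu).isPrime).irreducible

lemma isDiscreteValuationRing (he : 0 < e) [IsDomain (TameRing p e u)] (hu : u ≠ 0) :
    IsDiscreteValuationRing (TameRing p e u) := by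
  have := isLocalRing he hu
  have : IsNoetherianRing (TameRing p e u) := inferInstance
  have hf : ¬ IsField (TameRing p e u) := by
    intro hf
    rw [isField_iff_maximalIdeal_eq, maximalIdeal_eq he hu, Ideal.span_singleton_eq_bot] at hf
    exact root_ne_zero he hu hf
  -- The criterion used is that the maximal ideal is principal.
  refine ((IsDiscreteValuationRing.TFAE _ hf).out 4 0).mp ?_
  rw [maximalIdeal_eq he hu]
  exact ⟨⟨_, rfl⟩⟩

lemma isMixedCDVR (he : 0 < e) (hu : u ≠ 0) : IsMixedCDVR p e (TameRing p e u) := by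
  have h1 := isDomain (p := p) he hu
  have h2 := isDiscreteValuationRing (p := p) he hu
  have hker : RingHom.ker (toField he : TameRing p e u →+* k) = maximalIdeal _ := by
    rw [ker_toField he hu, maximalIdeal_eq he hu]
  let φ : ResidueField (TameRing p e u) ≃+* k :=
    (Ideal.quotEquivOfEq hker.symm).trans
      (RingHom.quotientKerEquivOfSurjective (toField_surjective he))
  have : PerfectField k := PerfectRing.toPerfectField k p
  refine
    { isAdicComplete := ?_
      charZero := charZero he hu
      charP_residueField := charP_of_injective_ringHom (f := (φ.symm : k →+* _)) φ.symm.injective p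
      perfectField_residueField := .of_ringEquiv φ.symm
      addVal_eq := ?_ }
  · rw [maximalIdeal_eq he hu]
    exact isAdicComplete_span_root he hu
  · have h3 : IsUnit (AdjoinRoot.of (tamePoly p e u) (teichmuller p u)) :=
      ((isUnit_iff_ne_zero.mpr hu).map (teichmuller p)).map _
    have h4 := congrArg (IsDiscreteValuationRing.addVal _) (root_pow (p := p) (e := e) (u := u))
    rw [(irreducible_root he hu).addVal_pow, IsDiscreteValuationRing.addVal_mul,
      (IsDiscreteValuationRing.addVal_eq_zero_iff).mpr h3, zero_add] at h4
    exact h4.symm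

end TameRing

end TameRing

/-! ### Presenting complete and Artinian rings by tame rings -/

section Presentation

variable {p e : ℕ} {R S : Type u} [CommRing R] [CommRing S]

lemma isUnit_natCast_of_charP_residueField [IsLocalRing R] (h : CharP (ResidueField R) p)
    (hpe : ¬ p ∣ e) : IsUnit (e : R) := by
  by_contra hu
  have h1 : (e : R) ∈ maximalIdeal R := hu
  rw [← residue_eq_zero_iff, map_natCast, CharP.cast_eq_zero_iff _ p] at h1
  exact hpe h1

lemma natCast_mem_maximalIdeal [IsLocalRing R] (h : CharP (ResidueField R) p) :
    (p : R) ∈ maximalIdeal R := by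
  rw [← residue_eq_zero_iff, map_natCast, CharP.cast_eq_zero]

variable [hp : Fact p.Prime]

/-- A complete local ring with principal maximal ideal in which `p` generates the `e`-th power of
the maximal ideal is a quotient of a tame ring. -/
lemma exists_tameRing_surjective [IsLocalRing R] [IsAdicComplete (maximalIdeal R) R]
    [hc : CharP (ResidueField R) p] [hk : PerfectField (ResidueField R)] (hpe : ¬ p ∣ e)
    (he : 0 < e) {t v : R} (ht : maximalIdeal R = Ideal.span {t}) (hv : IsUnit v)
    (hptv : (p : R) = t ^ e * v) :
    ∃ (u : ResidueField R) (_ : u ≠ 0) (φ : TameRing p e u →+* R), Function.Surjective φ ∧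
      (∀ x, residue R (φ (AdjoinRoot.of _ x)) = x.coeff 0) ∧
      ∃ w : R, IsUnit w ∧ φ (AdjoinRoot.root _) = t * w := by
  have := PerfectField.toPerfectRing (K := ResidueField R) p
  obtain ⟨g, hg⟩ := exists_wittVector_lift (p := p) (natCast_mem_maximalIdeal hc)
    (RingHom.id (ResidueField R))
  have hv' : residue R v ≠ 0 := by
    rw [residue_ne_zero_iff_isUnit]
    exact hv
  -- With `p = t^e * v`, the element `t * w` is a root exactly when `w^e = v * g [u]` (up to the
  -- annihilator of `t^e`). This `u` makes the right side `1` modulo `𝔪`, so Hensel starts at `1`.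
  let u := (residue R v)⁻¹
  have hu : u ≠ 0 := inv_ne_zero hv'
  have hg' (x) : residue R (g x) = x.coeff 0 := hg x
  obtain ⟨w, hw, hw1⟩ := exists_pow_eq he (isUnit_natCast_of_charP_residueField hc hpe)
    (a := v * g (WittVector.teichmuller p u)) isUnit_one (by
      rw [← residue_eq_zero_iff, map_sub, map_mul, hg', WittVector.teichmuller_coeff_zero,
        mul_inv_cancel₀ hv']
      simp)
  have hwu : IsUnit w := by
    rw [← residue_ne_zero_iff_isUnit, ← sub_add_cancel w 1, map_add,
      (residue_eq_zero_iff _).mpr hw1]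
    simp
  let φ : TameRing p e u →+* R := TameRing.lift g (t * w) (by
    rw [mul_pow, hw, hptv]
    ring)
  have hφr : φ (AdjoinRoot.root _) = t * w := TameRing.lift_root ..
  have hφo (x) : φ (AdjoinRoot.of _ x) = g x := TameRing.lift_of ..
  refine ⟨u, hu, φ, ?_, fun x => by rw [hφo, hg'], w, hwu, hφr⟩
  have hloc := TameRing.isLocalRing (p := p) he hu
  have hmax := TameRing.maximalIdeal_eq (p := p) he hu
  have : IsAdicComplete (maximalIdeal (TameRing p e u)) (TameRing p e u) := by
    rw [hmax]
    exact TameRing.isAdicComplete_span_root he hu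
  refine surjective_of_isAdicComplete φ ?_ fun y => ?_
  · rw [hmax, Ideal.map_span, Set.image_singleton, hφr, ht,
      Ideal.span_singleton_mul_right_unit hwu]
  · refine ⟨AdjoinRoot.of _ (WittVector.teichmuller p (residue R y)), ?_⟩
    rw [← residue_eq_zero_iff, map_sub, hφo, hg', WittVector.teichmuller_coeff_zero, sub_self]

/-- Nonzero elements are units times powers of `x`, so the kernel is determined by the first power
of `x` that dies. -/
lemma ker_eq_maximalIdeal_pow [IsDomain R] [IsDiscreteValuationRing R] {x : R}
    (hx : Irreducible x) (φ : R →+* S) {n : ℕ} (h0 : φ x ^ n = 0) (h1 : ∀ i < n, φ x ^ i ≠ 0) :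
    RingHom.ker φ = maximalIdeal R ^ n := by
  rw [hx.maximalIdeal_eq, Ideal.span_singleton_pow]
  apply le_antisymm
  · intro a ha
    by_cases ha0 : a = 0
    · rw [ha0]
      exact zero_mem _
    obtain ⟨i, c, rfl⟩ := IsDiscreteValuationRing.eq_unit_mul_pow_irreducible ha0 hx
    rw [RingHom.mem_ker, map_mul, (c.isUnit.map φ).mul_right_eq_zero, map_pow] at ha
    refine Ideal.mul_mem_left _ _ (Ideal.mem_span_singleton.mpr (pow_dvd_pow x ?_))
    by_contra! hi
    exact h1 i hi ha
  · rw [Ideal.span_singleton_le_iff_mem, RingHom.mem_ker, map_pow, h0]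

lemma IsMixedCDVR.exists_irreducible [IsLocalRing R] (h : IsMixedCDVR p e R) :
    ∃ t v : R, Irreducible t ∧ maximalIdeal R = Ideal.span {t} ∧ IsUnit v ∧
      (p : R) = t ^ e * v := by
  have := h.isDomain
  have := h.isDiscreteValuationRing
  obtain ⟨t, ht⟩ := IsDiscreteValuationRing.exists_irreducible R
  have h0 : (p : R) ≠ 0 := by
    have := h.charZero
    exact_mod_cast hp.out.ne_zero
  obtain ⟨i, c, hi⟩ := IsDiscreteValuationRing.eq_unit_mul_pow_irreducible h0 ht
  have h2 := h.addVal_eq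
  rw [hi, IsDiscreteValuationRing.addVal_mul, IsDiscreteValuationRing.addVal_eq_zero_iff.mpr
    c.isUnit, zero_add, ht.addVal_pow, Nat.cast_inj] at h2
  subst h2
  exact ⟨t, c, ht, ht.maximalIdeal_eq, c.isUnit, by rw [hi, mul_comm]⟩

/-- If `p ∤ e`, every object of `𝒞_{p,e}` is a tame ring over its residue field. -/
lemma IsMixedCDVR.exists_tameRing_equiv [IsLocalRing R] (h : IsMixedCDVR p e R) (hpe : ¬ p ∣ e)
    (he : 0 < e) :
    ∃ (u : ResidueField R) (_ : u ≠ 0) (φ : TameRing p e u ≃+* R),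
      ∀ x, residue R (φ (AdjoinRoot.of _ x)) = x.coeff 0 := by
  have := h.isDomain
  have := h.isAdicComplete
  have hc := h.charP_residueField
  have := h.perfectField_residueField
  have := PerfectField.toPerfectRing (K := ResidueField R) p
  obtain ⟨t, v, ht, hmax, hv, hptv⟩ := h.exists_irreducible
  obtain ⟨u, hu, φ, hφ, hres, w, hw, hφr⟩ := exists_tameRing_surjective hpe he hmax hv hptv
  have hT := TameRing.isDomain (p := p) he hu
  have hT' := TameRing.isDiscreteValuationRing (p := p) he hu
  refine ⟨u, hu, RingEquiv.ofBijective φ ⟨?_, hφ⟩, hres⟩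
  rw [injective_iff_map_eq_zero]
  intro a ha
  by_contra ha0
  obtain ⟨i, c, rfl⟩ := IsDiscreteValuationRing.eq_unit_mul_pow_irreducible ha0
    (TameRing.irreducible_root (p := p) he hu)
  rw [map_mul, (c.isUnit.map φ).mul_right_eq_zero, map_pow, hφr] at ha
  exact pow_ne_zero i (mul_ne_zero ht.ne_zero hw.ne_zero) ha

/-- If `p ∤ e`, every object of `ℛ_{p,e}^{e+1}` lifts to an object of `𝒞_{p,e}`. -/
lemma IsPrincipalArtinLocal.exists_lift (h : IsPrincipalArtinLocal p e (e + 1) R)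
    (hpe : ¬ p ∣ e) (he : 0 < e) :
    ∃ X : CatC.{u} p e, Nonempty (ResidueRing X.obj (e + 1) ≃+* R) := by
  have := h.isLocalRing
  have := h.isPrincipalIdealRing
  have := h.isArtinianRing
  have hc := h.charP_residueField
  have := h.perfectField_residueField
  have := PerfectField.toPerfectRing (K := ResidueField R) p
  obtain ⟨t, ht⟩ := (IsPrincipalIdealRing.principal (maximalIdeal R)).principal
  have ht' : ∀ k, maximalIdeal R ^ k = Ideal.span {t ^ k} := fun k => by
    rw [ht]; exact Ideal.span_singleton_pow t k
  obtain ⟨hp1, hp2⟩ := h.mem_and_notMem e.lt_succ_self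
  have hp1' := hp1
  rw [ht', Ideal.mem_span_singleton] at hp1'
  obtain ⟨v, hptv⟩ := hp1'
  have hv : IsUnit v := by
    by_contra hv
    have hv' : v ∈ maximalIdeal R := hv
    refine hp2 ?_
    rw [hptv, pow_succ]
    exact Ideal.mul_mem_mul (by rw [ht']; exact Ideal.mem_span_singleton_self _) hv'
  obtain ⟨u, hu, φ, hφ, hres, w, hw, hφr⟩ := exists_tameRing_surjective hpe he ht hv hptv
  have hT := TameRing.isMixedCDVR (p := p) he hu
  have := hT.isDomain
  have := hT.isDiscreteValuationRing
  -- The quotient by this power already has the full length `e + 1`, and a quotient by a nonzero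
  -- ideal would be strictly shorter.
  have hbot : maximalIdeal R ^ (e + 1) = ⊥ := by
    have hlen := length_residueRing_aux (R := R) (n := e + 1) fun j hj =>
      pow_succ_ne_of_length h.length_eq hj
    by_contra hne
    have hlt : Module.length R (R ⧸ maximalIdeal R ^ (e + 1)) < Module.length R R :=
      Submodule.length_quotient_lt _ hne
    rw [hlen, h.length_eq] at hlt
    exact lt_irrefl _ hlt
  have hker : RingHom.ker φ = maximalIdeal (TameRing p e u) ^ (e + 1) := by
    refine ker_eq_maximalIdeal_pow (TameRing.irreducible_root he hu) φ ?_ fun i hi h0 => ?_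
    · rw [hφr, mul_pow, Ideal.span_singleton_eq_bot.mp ((ht' _).symm.trans hbot), zero_mul]
    · rw [hφr, mul_pow, (hw.pow i).mul_left_eq_zero] at h0
      refine pow_succ_ne_of_length h.length_eq hi ?_
      rw [ht', ht', pow_succ, h0, zero_mul]
  exact ⟨⟨CommRingCat.of (TameRing p e u), hT⟩, ⟨(Ideal.quotEquivOfEq hker.symm).trans
    (RingHom.quotientKerEquivOfSurjective hφ)⟩⟩

end Presentation

/-! ### Existence and uniqueness of lifts of homomorphisms -/

section UniqueLift

variable {p e : ℕ} {R S : Type u} [CommRing R] [CommRing S]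
  [IsLocalRing R] [IsLocalRing S]

lemma mem_maximalIdeal_pow_of_residueRing_hom (hR : IsMixedCDVR p e R) {n : ℕ} (hn : 0 < n)
    (f : ResidueRing R n →+* ResidueRing S n) {i : ℕ} (hi : i ≤ n) {a : R} {b : S}
    (ha : a ∈ maximalIdeal R ^ i) (hab : f (Ideal.Quotient.mk _ a) = Ideal.Quotient.mk _ b) :
    b ∈ maximalIdeal S ^ i := by
  have := isLocalRing_residueRing (R := R) hn
  have := isLocalRing_residueRing (R := S) hn
  rw [← mk_mem_pow_iff hi] at ha ⊢
  rw [← hab]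
  exact (Ideal.pow_right_mono ((hR.residueRing hn).maximalIdeal_le_comap f) i).trans
    (Ideal.le_comap_pow f i) ha

variable [hp : Fact p.Prime]

/-- On `W(k)` the maps agree because they agree modulo `𝔪`. The two images of the root have the same
`e`-th power and are uniformizers congruent modulo `𝔪^2`; their ratio is therefore `1` modulo `𝔪`
with `e`-th power `1`, hence equal to `1`. -/
lemma IsMixedCDVR.hom_ext (hR : IsMixedCDVR p e R) (hS : IsMixedCDVR p e S) (hpe : ¬ p ∣ e)
    (he : 0 < e) {F F' : R →+* S} (h : ∀ a, F a - F' a ∈ maximalIdeal S ^ 2) : F = F' := by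
  have := hS.isDomain
  have := hS.isDiscreteValuationRing
  have := hS.isAdicComplete
  have := hR.charP_residueField
  have := hR.perfectField_residueField
  have := PerfectField.toPerfectRing (K := ResidueField R) p
  obtain ⟨u, hu, φ, -⟩ := hR.exists_tameRing_equiv hpe he
  obtain ⟨t, c, ht, hmax, hc, hptc⟩ := hS.exists_irreducible
  have hof : (F.comp (φ : TameRing p e u →+* R)).comp (AdjoinRoot.of _) =
      (F'.comp (φ : TameRing p e u →+* R)).comp (AdjoinRoot.of _) :=
    wittVector_hom_ext (natCast_mem_maximalIdeal hS.charP_residueField)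
      fun x => Ideal.pow_le_self two_ne_zero (h _)
  have hroot (G : R →+* S) : ∃ w, IsUnit w ∧ G (φ (AdjoinRoot.root _)) = t * w := by
    have h1 := congrArg (G.comp (φ : TameRing p e u →+* R)) (TameRing.root_pow (p := p) (u := u))
    have h2 : IsUnit (G (φ (AdjoinRoot.of (tamePoly p e u) (WittVector.teichmuller p u)))) :=
      (((isUnit_iff_ne_zero.mpr hu).map (WittVector.teichmuller p)).map
        (AdjoinRoot.of (tamePoly p e u))).map (G.comp (φ : TameRing p e u →+* R))
    simp only [RingHom.comp_apply, map_pow, map_mul, map_natCast, RingHom.coe_coe] at h1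
    have h3 : G (φ (AdjoinRoot.root _)) ∈ maximalIdeal S := by
      refine (maximalIdeal.isMaximal S).isPrime.mem_of_pow_mem e ?_
      rw [h1]
      exact Ideal.mul_mem_left _ _ (natCast_mem_maximalIdeal hS.charP_residueField)
    rw [hmax, Ideal.mem_span_singleton] at h3
    obtain ⟨w, hw⟩ := h3
    refine ⟨w, ?_, hw⟩
    rw [hw, mul_pow, hptc, mul_left_comm] at h1
    have h4 := mul_left_cancel₀ (pow_ne_zero e ht.ne_zero) h1
    rw [← isUnit_pow_iff he.ne', h4]
    exact h2.mul hc
  obtain ⟨w, hw, hFw⟩ := hroot F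
  obtain ⟨w', hw', hFw'⟩ := hroot F'
  have hpow : F (φ (AdjoinRoot.root _)) ^ e = F' (φ (AdjoinRoot.root _)) ^ e := by
    simp only [← map_pow, TameRing.root_pow]
    have := DFunLike.congr_fun hof (WittVector.teichmuller p u)
    simp only [RingHom.comp_apply, RingHom.coe_coe] at this
    simp only [map_mul, map_natCast, this]
  have hdiff := h (φ (AdjoinRoot.root _))
  rw [hFw, hFw', ← mul_sub, hmax, Ideal.span_singleton_pow, Ideal.mem_span_singleton, sq,
    mul_dvd_mul_iff_left ht.ne_zero, ← Ideal.mem_span_singleton, ← hmax] at hdiff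
  obtain ⟨w, rfl⟩ := hw
  have hv : (↑w⁻¹ * w' : S) = 1 := by
    refine eq_of_pow_eq (e := e)
      (isUnit_natCast_of_charP_residueField hS.charP_residueField hpe)
      (y := t * w) (mul_ne_zero ht.ne_zero w.ne_zero) ?_ ?_
    · have h5 := Ideal.mul_mem_left _ (-(↑w⁻¹ : S)) hdiff
      rwa [show -(↑w⁻¹ : S) * (w - w') = ↑w⁻¹ * w' - ↑w⁻¹ * w by ring, Units.inv_mul] at h5
    · rw [mul_assoc, Units.mul_inv_cancel_left, ← hFw, ← hFw', hpow]
  have hroot_eq : F (φ (AdjoinRoot.root _)) = F' (φ (AdjoinRoot.root _)) := by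
    rw [hFw, hFw', ← Units.mul_inv_cancel_left w w', hv, mul_one]
  have hcomp : F.comp (φ : TameRing p e u →+* R) = F'.comp (φ : TameRing p e u →+* R) :=
    AdjoinRoot.ringHom_ext hof hroot_eq
  ext a
  obtain ⟨a, rfl⟩ := φ.surjective a
  exact DFunLike.congr_fun hcomp a

/-- If `p ∤ e`, every homomorphism modulo `𝔪 ^ (e + 1)` agrees modulo `𝔪 ^ 2` with a homomorphism
of objects of `𝒞_{p,e}`. -/
lemma IsMixedCDVR.exists_hom (hR : IsMixedCDVR p e R) (hS : IsMixedCDVR p e S) (hpe : ¬ p ∣ e)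
    (he : 1 < e) (f : ResidueRing R (e + 1) →+* ResidueRing S (e + 1)) :
    ∃ F : R →+* S, ∀ a b, f (Ideal.Quotient.mk _ a) = Ideal.Quotient.mk _ b →
      F a - b ∈ maximalIdeal S ^ 2 := by
  have he0 : 0 < e := by omega
  have := hS.isDomain
  have := hS.isDiscreteValuationRing
  have := hS.isAdicComplete
  have := hR.charP_residueField
  have := hR.perfectField_residueField
  have := PerfectField.toPerfectRing (K := ResidueField R) p
  obtain ⟨u, hu, φ, hφ⟩ := hR.exists_tameRing_equiv hpe he0
  obtain ⟨t, c, ht, hmax, hc, hptc⟩ := hS.exists_irreducible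
  have hpS := natCast_mem_maximalIdeal hS.charP_residueField
  have hloc := isLocalRing_residueRing (R := S) e.succ_pos
  let h : R →+* ResidueRing S (e + 1) := f.comp (Ideal.Quotient.mk _)
  have hrel (a : R) : ∃ b, h a = Ideal.Quotient.mk _ b :=
    (Ideal.Quotient.mk_surjective (h a)).imp fun _ => Eq.symm
  let ρ : ResidueRing S (e + 1) →+* ResidueField S :=
    Ideal.Quotient.factor (Ideal.pow_le_self e.succ_ne_zero)
  have hρ (b : S) : ρ (Ideal.Quotient.mk _ b) = residue S b := rfl
  let σ : ResidueField R →+* ResidueField S := Ideal.Quotient.lift _ (ρ.comp h) fun a ha => by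
    obtain ⟨b, hb⟩ := hrel a
    rw [RingHom.comp_apply, hb, hρ, residue_eq_zero_iff, ← pow_one (maximalIdeal S)]
    exact mem_maximalIdeal_pow_of_residueRing_hom hR e.succ_pos f (Nat.succ_le_succ e.zero_le)
      (by rwa [pow_one]) hb
  have hσ (a : R) : σ (residue R a) = ρ (h a) := rfl
  obtain ⟨g, hg⟩ := exists_wittVector_lift (p := p) hpS σ
  have hg' (x) : residue S (g x) = σ (x.coeff 0) := hg x
  -- On the Witt vectors the lift `g`, built from the residue map `σ` alone, agrees with `f` modulo
  -- the full `𝔪^(e+1)`, by uniqueness.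
  have hhg : (h.comp (φ : TameRing p e u →+* R)).comp (AdjoinRoot.of _) =
      (Ideal.Quotient.mk _).comp g := by
    refine wittVector_hom_ext (I := maximalIdeal (ResidueRing S (e + 1))) ?_ fun x => ?_
    · rw [← map_natCast (Ideal.Quotient.mk (maximalIdeal S ^ (e + 1))),
        ← pow_one (maximalIdeal (ResidueRing S (e + 1))), mk_mem_pow_iff (by omega), pow_one]
      exact hpS
    · obtain ⟨b, hb⟩ := hrel (φ (AdjoinRoot.of _ x))
      have : (h.comp (φ : TameRing p e u →+* R)).comp (AdjoinRoot.of _) x =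
        Ideal.Quotient.mk _ b := hb
      rw [this, RingHom.comp_apply, ← map_sub, ← pow_one (maximalIdeal (ResidueRing S (e + 1))),
        mk_mem_pow_iff (by omega), pow_one, ← residue_eq_zero_iff, map_sub, ← hρ, ← hb, ← hσ,
        hφ, hg', sub_self]
  have hhg' (x) : h (φ (AdjoinRoot.of _ x)) = Ideal.Quotient.mk _ (g x) :=
    DFunLike.congr_fun hhg x
  obtain ⟨y, hy⟩ := hrel (φ (AdjoinRoot.root _))
  have hye : y ^ e - g (WittVector.teichmuller p u) * p ∈ maximalIdeal S ^ (e + 1) := by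
    rw [← Ideal.Quotient.eq, map_pow, ← hy, map_mul, ← hhg', map_natCast, ← map_pow, ← map_pow,
      TameRing.root_pow, map_mul, map_mul, map_natCast, map_natCast]
  have hym : y ∈ maximalIdeal S := by
    refine (maximalIdeal.isMaximal S).isPrime.mem_of_pow_mem e ?_
    rw [← sub_add_cancel (y ^ e) (g (WittVector.teichmuller p u) * p)]
    exact add_mem (Ideal.pow_le_self e.succ_ne_zero hye) (Ideal.mul_mem_left _ _ hpS)
  rw [hmax, Ideal.mem_span_singleton] at hym
  obtain ⟨z, rfl⟩ := hym
  -- Cancelling `t^e` costs `e` of the `e + 1` digits; the one that remains is what Hensel's lemma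
  -- needs.
  have hze : z ^ e - g (WittVector.teichmuller p u) * c ∈ maximalIdeal S := by
    rw [mul_pow, hptc, mul_left_comm, ← mul_sub, hmax, Ideal.span_singleton_pow,
      Ideal.mem_span_singleton, pow_succ, mul_dvd_mul_iff_left (pow_ne_zero e ht.ne_zero),
      ← Ideal.mem_span_singleton, ← hmax] at hye
    exact hye
  have hgu : IsUnit (g (WittVector.teichmuller p u)) :=
    ((isUnit_iff_ne_zero.mpr hu).map (WittVector.teichmuller p)).map g
  have hzu : IsUnit z := by
    rw [← isUnit_pow_iff he0.ne', ← residue_ne_zero_iff_isUnit,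
      ← sub_add_cancel (z ^ e) (g (WittVector.teichmuller p u) * c), map_add,
      (residue_eq_zero_iff _).mpr hze, zero_add, residue_ne_zero_iff_isUnit]
    exact hgu.mul hc
  obtain ⟨w, hw, hwz⟩ := exists_pow_eq he0
    (isUnit_natCast_of_charP_residueField hS.charP_residueField hpe) hzu hze
  let G : TameRing p e u →+* S := TameRing.lift g (t * w) (by
    rw [mul_pow, hw, hptc]
    ring)
  let ρ₂ : ResidueRing S (e + 1) →+* S ⧸ maximalIdeal S ^ 2 :=
    Ideal.Quotient.factor (Ideal.pow_le_pow_right (by omega))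
  have hρ₂ (b : S) : ρ₂ (Ideal.Quotient.mk _ b) = Ideal.Quotient.mk _ b := rfl
  have hG : (Ideal.Quotient.mk (maximalIdeal S ^ 2)).comp G =
      ρ₂.comp (h.comp (φ : TameRing p e u →+* R)) := by
    refine AdjoinRoot.ringHom_ext ?_ ?_
    · ext x
      change Ideal.Quotient.mk _ (G (AdjoinRoot.of _ x)) = ρ₂ (h (φ (AdjoinRoot.of _ x)))
      rw [hhg', hρ₂, TameRing.lift_of]
    · change Ideal.Quotient.mk _ (G (AdjoinRoot.root _)) = ρ₂ (h (φ (AdjoinRoot.root _)))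
      -- The error is `t * (w - z)` with `w - z ∈ 𝔪`, which explains the precision `𝔪^2`.
      rw [hy, hρ₂, TameRing.lift_root, Ideal.Quotient.eq, ← mul_sub, sq]
      exact Ideal.mul_mem_mul (by rw [hmax]; exact Ideal.mem_span_singleton_self t) hwz
  refine ⟨G.comp (φ.symm : R →+* TameRing p e u), fun a b hab => ?_⟩
  have h1 := DFunLike.congr_fun hG (φ.symm a)
  have h2 : h (φ (φ.symm a)) = Ideal.Quotient.mk _ b := by
    rw [φ.apply_symm_apply]
    exact hab
  rw [← Ideal.Quotient.eq, ← hρ₂ b, ← h2]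
  exact h1

end UniqueLift

/-! ### Functors from unique lifts of morphisms -/

section UniqueLiftFunctor

/-- If `P : C ⥤ D` is essentially surjective and each morphism `P X ⟶ P Y` has a unique lift to `C`
after applying `Q : D ⥤ E`, then the lifts define a functor `D ⥤ C`. -/
lemma exists_functor_of_existsUnique_lift {C D E : Type*} [Category* C] [Category* D] [Category* E]
    (P : C ⥤ D) (Q : D ⥤ E) (hP : ∀ d, ∃ c, Nonempty (P.obj c ≅ d))
    (hex : ∀ {X Y : C} (f : P.obj X ⟶ P.obj Y), ∃ F : X ⟶ Y, Q.map (P.map F) = Q.map f)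
    (huniq : ∀ {X Y : C} (F G : X ⟶ Y), Q.map (P.map F) = Q.map (P.map G) → F = G) :
    ∃ (L : D ⥤ C) (φ : ∀ d, P.obj (L.obj d) ≅ d),
      (∀ {d d' : D} (f : d ⟶ d'),
        Q.map (P.map (L.map f)) = Q.map ((φ d).hom ≫ f ≫ (φ d').inv)) ∧
      Nonempty (P ⋙ L ≅ 𝟭 C) := by
  choose obj hobj using hP
  let φ (d : D) : P.obj (obj d) ≅ d := (hobj d).some
  choose lift hlift using @hex
  let L : D ⥤ C :=
    { obj := obj
      map := fun {d d'} f => lift ((φ d).hom ≫ f ≫ (φ d').inv)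
      map_id := fun d => huniq _ _ (by rw [hlift]; simp)
      map_comp := fun f g => huniq _ _ (by
        simp only [Functor.map_comp, hlift]
        simp) }
  have hL {d d' : D} (f : d ⟶ d') :
      Q.map (P.map (L.map f)) = Q.map ((φ d).hom ≫ f ≫ (φ d').inv) := hlift _
  -- The components lift `φ (P.obj X)`; all their identities are checked after applying `P` and `Q`.
  refine ⟨L, φ, hL, ⟨NatIso.ofComponents (fun X =>
    { hom := lift (φ (P.obj X)).hom
      inv := lift (φ (P.obj X)).inv
      hom_inv_id := huniq _ _ (by
        simp only [Functor.map_comp, hlift]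
        simp [L])
      inv_hom_id := huniq _ _ (by
        simp only [Functor.map_comp, hlift]
        simp) }) fun {X Y} f => huniq _ _ ?_⟩⟩
  simp only [Functor.map_comp, Functor.comp_map, hL, hlift]
  simp

end UniqueLiftFunctor

/-! ### Liftability from level `e + 1` -/

section Liftable

variable {p e : ℕ}

lemma PrR_map_eq_iff {m n : ℕ} (hn : 0 < n) (hnm : n ≤ m) {A B : CatR.{u} p e m} (f g : A ⟶ B) :
    (PrR p e hn hnm).map f = (PrR p e hn hnm).map g ↔
      ∀ a, f.hom.hom a - g.hom.hom a ∈ maximalIdeal B.obj ^ n := by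
  constructor
  · intro h a
    rw [← Ideal.Quotient.eq]
    exact congrArg (fun φ => φ.hom.hom (Ideal.Quotient.mk _ a)) h
  · intro h
    ext x
    obtain ⟨a, rfl⟩ := Ideal.Quotient.mk_surjective x
    exact Ideal.Quotient.eq.mpr (h a)

/-- An isomorphism of objects of `ℛ_{p,e}^n` given by a ring isomorphism. -/
noncomputable def CatR.isoOfRingEquiv {n : ℕ} {A B : CatR.{u} p e n} (φ : A.obj ≃+* B.obj) :
    A ≅ B :=
  ObjectProperty.isoMk _ φ.toCommRingCatIso

/-- The projection to the `n`-th residue ring factors through the `m`-th one. -/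
lemma nonempty_Pr_iso {m n : ℕ} (hm : 0 < m) (hn : 0 < n) (hnm : n ≤ m) :
    Nonempty (Pr.{u} p e hn ≅ Pr p e hm ⋙ PrR p e hn hnm) := by
  have hloc (X : CatC.{u} p e) : IsLocalRing (ResidueRing X.obj m) := isLocalRing_residueRing hm
  let F (X : CatC.{u} p e) :
      ResidueRing X.obj n →+* ResidueRing ((Pr p e hm).obj X).obj n :=
    Ideal.Quotient.lift _ ((Ideal.Quotient.mk _).comp (Ideal.Quotient.mk _)) fun a ha =>
      Ideal.Quotient.eq_zero_iff_mem.mpr ((mk_mem_pow_iff hnm a).mpr ha)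
  have hF (X : CatC.{u} p e) : Function.Bijective (F X) := by
    constructor
    · rw [injective_iff_map_eq_zero]
      intro x hx
      obtain ⟨a, rfl⟩ := Ideal.Quotient.mk_surjective x
      rw [Ideal.Quotient.eq_zero_iff_mem]
      exact (mk_mem_pow_iff hnm a).mp (Ideal.Quotient.eq_zero_iff_mem.mp hx)
    · intro y
      obtain ⟨y, rfl⟩ := Ideal.Quotient.mk_surjective y
      obtain ⟨a, rfl⟩ := Ideal.Quotient.mk_surjective y
      exact ⟨Ideal.Quotient.mk _ a, rfl⟩
  refine ⟨NatIso.ofComponents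
    (fun X => CatR.isoOfRingEquiv (RingEquiv.ofBijective (F X) (hF X))) fun {X Y} f => ?_⟩
  ext x
  obtain ⟨a, rfl⟩ := Ideal.Quotient.mk_surjective x
  rfl

/-- In the tame case, `𝒞_{p,e}` is `(e + 1)`-liftable. -/
lemma isLiftable_succ [Fact p.Prime] (hpe : ¬ p ∣ e) (he : 1 < e) :
    IsLiftable.{u} p e (e + 1) := by
  have hloc (X : CatC.{u} p e) : IsLocalRing (ResidueRing X.obj (e + 1)) :=
    isLocalRing_residueRing e.succ_pos
  obtain ⟨L, φ, hL, hid⟩ := exists_functor_of_existsUnique_lift (Pr.{u} p e e.succ_pos)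
    (PrR p e two_pos (Nat.succ_le_succ he.le))
    (fun A => by
      obtain ⟨X, ⟨ψ⟩⟩ := A.property.exists_lift hpe (by omega)
      exact ⟨X, ⟨CatR.isoOfRingEquiv ψ⟩⟩)
    (fun {X Y} f => by
      obtain ⟨F, hF⟩ := X.property.exists_hom Y.property hpe he f.hom.hom
      refine ⟨ObjectProperty.homMk (CommRingCat.ofHom F), (PrR_map_eq_iff _ _ _ _).mpr fun a => ?_⟩
      obtain ⟨a, rfl⟩ := Ideal.Quotient.mk_surjective a
      obtain ⟨b, hb⟩ := Ideal.Quotient.mk_surjective (f.hom.hom (Ideal.Quotient.mk _ a))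
      rw [← hb]
      exact (mk_mem_pow_iff (Nat.succ_le_succ he.le) _).mpr (hF a b hb.symm))
    (fun {X Y} F G h => by
      rw [PrR_map_eq_iff] at h
      have : F.hom.hom = G.hom.hom := X.property.hom_ext Y.property hpe (by omega) fun a =>
        (mk_mem_pow_iff (Nat.succ_le_succ he.le) _).mp (h (Ideal.Quotient.mk _ a))
      ext a
      exact DFunLike.congr_fun this a)
  refine ⟨e.succ_pos, L, fun A => ⟨φ A⟩, ?_, hid⟩
  obtain ⟨ι⟩ := nonempty_Pr_iso.{u} (p := p) (e := e) e.succ_pos one_pos e.succ_pos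
  refine ⟨(Functor.isoWhiskerLeft L ι) ≪≫ NatIso.ofComponents
    (fun A => (PrR p e one_pos (Nat.succ_le_of_lt e.succ_pos)).mapIso (φ A)) fun {A B} f => ?_⟩
  -- Agreement modulo `𝔪^2` implies agreement on residue fields, so the isomorphisms `φ` become
  -- natural there.
  have h1 : (PrR p e one_pos e.succ_pos).map ((Pr p e e.succ_pos).map (L.map f)) =
      (PrR p e one_pos e.succ_pos).map ((φ A).hom ≫ f ≫ (φ B).inv) := by
    rw [PrR_map_eq_iff]
    exact fun a => Ideal.pow_le_pow_right one_le_two ((PrR_map_eq_iff _ _ _ _).mp (hL f) a)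
  change (PrR p e one_pos e.succ_pos).map ((Pr p e e.succ_pos).map (L.map f)) ≫
    (PrR p e one_pos e.succ_pos).map (φ B).hom = (PrR p e one_pos e.succ_pos).map (φ A).hom ≫ _
  rw [h1, ← Functor.map_comp, ← Functor.map_comp]
  simp

end Liftable

/-! ### Tame rings that residue rings cannot distinguish -/

section NotLiftable

variable {p e : ℕ}

/-- In an `n`-liftable category the objects are determined by their `n`-th residue rings. -/
lemma IsLiftable.nonempty_iso {n : ℕ} (h : IsLiftable.{u} p e n) {X Y : CatC.{u} p e}
    (φ : ResidueRing X.obj n ≃+* ResidueRing Y.obj n) : Nonempty (X ≅ Y) := by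
  obtain ⟨hn, L, hL⟩ := h
  obtain ⟨ι⟩ := hL.id_iso
  exact ⟨(ι.app X).symm ≪≫ L.mapIso
    (CatR.isoOfRingEquiv (A := (Pr p e hn).obj X) (B := (Pr p e hn).obj Y) φ) ≪≫ ι.app Y⟩

variable [hp : Fact p.Prime] {k : Type u} [Field k] [CharP k p] [PerfectRing k p]

/-- The `n`-th residue rings of all tame rings over `k` are isomorphic if `n ≤ e`. -/
lemma TameRing.nonempty_residueRing_equiv (he : 0 < e) {n : ℕ} (hne : n ≤ e) {u v : k}
    (hu : u ≠ 0) (hv : v ≠ 0) [IsLocalRing (TameRing p e u)] [IsLocalRing (TameRing p e v)] :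
    Nonempty (ResidueRing (TameRing p e u) n ≃+* ResidueRing (TameRing p e v) n) := by
  have := TameRing.isDomain (p := p) he hu
  have := TameRing.isDiscreteValuationRing (p := p) he hu
  have hmax := TameRing.maximalIdeal_eq (p := p) he hv
  have hr : (AdjoinRoot.root (tamePoly p e v)) ^ n ∈ maximalIdeal (TameRing p e v) ^ n := by
    rw [hmax]
    exact Ideal.pow_mem_pow (Ideal.mem_span_singleton_self _) n
  have hp0 : (p : ResidueRing (TameRing p e v) n) = 0 := by
    rw [← map_natCast (Ideal.Quotient.mk _), Ideal.Quotient.eq_zero_iff_mem,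
      (TameRing.isMixedCDVR he hv).mem_pow_iff]
    exact hne
  have hr0 : (Ideal.Quotient.mk (maximalIdeal (TameRing p e v) ^ n)
      (AdjoinRoot.root (tamePoly p e v))) ^ n = 0 := by
    rw [← map_pow, Ideal.Quotient.eq_zero_iff_mem]
    exact hr
  let φ : TameRing p e u →+* ResidueRing (TameRing p e v) n :=
    TameRing.lift ((Ideal.Quotient.mk _).comp (AdjoinRoot.of _))
      (Ideal.Quotient.mk _ (AdjoinRoot.root _)) (by
        rw [hp0, mul_zero]
        exact pow_eq_zero_of_le hne hr0)
  have hφr : φ (AdjoinRoot.root _) = Ideal.Quotient.mk _ (AdjoinRoot.root _) := lift_root ..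
  have hφo (x) : φ (AdjoinRoot.of _ x) = Ideal.Quotient.mk _ (AdjoinRoot.of _ x) := lift_of ..
  have hsurj : Function.Surjective φ := by
    intro y
    obtain ⟨y, rfl⟩ := Ideal.Quotient.mk_surjective y
    obtain ⟨f, rfl⟩ := AdjoinRoot.mk_surjective y
    refine ⟨AdjoinRoot.mk _ f, ?_⟩
    induction f using Polynomial.induction_on' with
    | add f g hf hg => rw [map_add, map_add, hf, hg, map_add, map_add]
    | monomial i a =>
      rw [← Polynomial.C_mul_X_pow_eq_monomial, map_mul, map_mul, map_pow, map_pow,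
        AdjoinRoot.mk_X, hφr, AdjoinRoot.mk_C, hφo, map_mul, map_pow, map_mul, map_pow,
        AdjoinRoot.mk_X, AdjoinRoot.mk_C]
  have hker : RingHom.ker φ = maximalIdeal (TameRing p e u) ^ n := by
    refine ker_eq_maximalIdeal_pow (TameRing.irreducible_root he hu) φ ?_ fun i hi h0 => ?_
    · rw [hφr, hr0]
    · rw [hφr, ← map_pow, Ideal.Quotient.eq_zero_iff_mem, hmax, Ideal.span_singleton_pow,
        Ideal.mem_span_singleton] at h0
      have := TameRing.isDomain (p := p) he hv
      have hirr := TameRing.irreducible_root (p := p) he hv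
      exact hi.not_ge ((pow_dvd_pow_iff hirr.ne_zero hirr.not_isUnit).mp h0)
  exact ⟨(Ideal.quotEquivOfEq hker.symm).trans (RingHom.quotientKerEquivOfSurjective hsurj)⟩

/-- If the tame rings given by `u` and `1` are isomorphic, then `u` is an `e`-th power. -/
lemma TameRing.exists_pow_eq_of_equiv (he : 0 < e) {u : k} (hu : u ≠ 0)
    (τ : TameRing p e u ≃+* TameRing p e (1 : k)) : ∃ x : k, x ^ e = u := by
  have := TameRing.isDomain (p := p) he hu
  have := TameRing.charZero (p := p) he hu
  have hp0 : (p : TameRing p e u) ≠ 0 := Nat.cast_ne_zero.mpr hp.out.ne_zero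
  have h1 := TameRing.root_pow (p := p) (e := e) (u := u)
  -- As `τ` need not be `W(k)`-linear, the comparison is with `u = 1`: the relation `root^e = p` is
  -- preserved by every isomorphism.
  have h2 := congrArg τ.symm (TameRing.root_pow (p := p) (e := e) (u := (1 : k)))
  rw [map_one, map_one, one_mul, map_pow, map_natCast] at h2
  have hloc := TameRing.isLocalRing (p := p) he hu
  have hy : AdjoinRoot.root (tamePoly p e u) ∈
      Ideal.span {τ.symm (AdjoinRoot.root (tamePoly p e (1 : k)))} := by
    have h3 : (Ideal.span {AdjoinRoot.root (tamePoly p e (1 : k))}).map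
        (τ.symm : TameRing p e (1 : k) →+* TameRing p e u) = maximalIdeal (TameRing p e u) := by
      have := TameRing.isMaximal_span_root (p := p) he (one_ne_zero (α := k))
      exact (IsLocalRing.eq_maximalIdeal (Ideal.map_isMaximal_of_equiv τ.symm))
    rw [Ideal.map_span, Set.image_singleton, RingHom.coe_coe] at h3
    rw [h3, TameRing.maximalIdeal_eq he hu]
    exact Ideal.mem_span_singleton_self _
  obtain ⟨w, hw⟩ := Ideal.mem_span_singleton.mp hy
  rw [hw, mul_pow, h2, mul_comm] at h1
  have h3 := mul_right_cancel₀ hp0 h1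
  refine ⟨TameRing.toField he w, ?_⟩
  rw [← map_pow, h3, TameRing.toField, TameRing.lift_of]
  exact WittVector.teichmuller_coeff_zero p u

end NotLiftable

/-! ### A non-`e`-th power in a finite field, and the lower bound -/

section Main

variable {p e : ℕ}

/-- If `p` does not divide `e > 1`, then some finite field of characteristic `p` contains an
element which is not an `e`-th power. -/
lemma exists_field_not_pow [hp : Fact p.Prime] (hpe : ¬ p ∣ e) (he : 1 < e) :
    ∃ (k : Type u) (_ : Field k) (_ : CharP k p) (_ : PerfectRing k p) (u : k), u ≠ 0 ∧
      ∀ x : k, x ^ e ≠ u := by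
  -- By Euler, `e` divides `p^f - 1`, the order of the unit group. A unit whose order is a prime
  -- factor of `e` then lies in the kernel of `x ↦ x^e`, so on this finite group the map is not
  -- surjective either.
  let f := e.totient
  have hf : f ≠ 0 := (Nat.totient_pos.mpr (by omega)).ne'
  let k := GaloisField p f
  have := Fintype.ofFinite k
  let ℓ := e.minFac
  have hℓ : Fact ℓ.Prime := ⟨Nat.minFac_prime (by omega)⟩
  have hdvd : ℓ ∣ Nat.card kˣ := by
    have h1 : p ^ f ≡ 1 [MOD e] :=
      Nat.ModEq.pow_totient ((Nat.Prime.coprime_iff_not_dvd hp.out).mpr hpe)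
    rw [Nat.card_units, GaloisField.card p f hf]
    exact (Nat.minFac_dvd e).trans ((Nat.modEq_iff_dvd' (Nat.one_le_pow _ _ hp.out.pos)).mp h1.symm)
  obtain ⟨ζ, hζ⟩ := exists_prime_orderOf_dvd_card' ℓ hdvd
  have hninj : ¬ Function.Injective (fun x : kˣ => x ^ e) := by
    intro hinj
    have h1 : ζ = 1 := hinj (by
      change ζ ^ e = 1 ^ e
      rw [one_pow, ← orderOf_dvd_iff_pow_eq_one, hζ]
      exact Nat.minFac_dvd e)
    rw [h1, orderOf_one] at hζ
    exact hℓ.out.one_lt.ne hζ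
  rw [Finite.injective_iff_surjective] at hninj
  simp only [Function.Surjective, not_forall, not_exists] at hninj
  obtain ⟨u, hu⟩ := hninj
  refine ⟨ULift.{u} k, inferInstance, inferInstance,
    PerfectField.toPerfectRing (K := ULift.{u} k) p, ULift.up u, ?_, fun x hx => ?_⟩
  · exact fun h => u.ne_zero (congrArg ULift.down h)
  · have hx' : x.down ^ e = u := congrArg ULift.down hx
    have hx0 : x.down ≠ 0 := by
      intro h
      rw [h, zero_pow (by omega)] at hx'
      exact u.ne_zero hx'.symm
    exact hu (Units.mk0 _ hx0) (Units.ext hx')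

/-- In the tame case with `e > 1`, `𝒞_{p,e}` is not `n`-liftable for `n ≤ e`. -/
lemma IsLiftable.lt [hp : Fact p.Prime] (hpe : ¬ p ∣ e) (he : 1 < e) {n : ℕ}
    (h : IsLiftable.{u} p e n) : e < n := by
  by_contra! hne
  have he0 : 0 < e := by omega
  obtain ⟨k, _, _, _, u, hu, hpow⟩ := exists_field_not_pow.{u} hpe he
  let X : CatC.{u} p e := ⟨CommRingCat.of (TameRing p e u), TameRing.isMixedCDVR he0 hu⟩
  let Y : CatC.{u} p e :=
    ⟨CommRingCat.of (TameRing p e (1 : k)), TameRing.isMixedCDVR he0 one_ne_zero⟩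
  have hX : IsLocalRing (TameRing p e u) := TameRing.isLocalRing he0 hu
  have hY : IsLocalRing (TameRing p e (1 : k)) := TameRing.isLocalRing he0 one_ne_zero
  obtain ⟨φ⟩ := TameRing.nonempty_residueRing_equiv (p := p) he0 hne hu
    (one_ne_zero (α := k))
  obtain ⟨τ⟩ := h.nonempty_iso (X := X) (Y := Y) φ
  obtain ⟨x, hx⟩ := TameRing.exists_pow_eq_of_equiv he0 hu
    ((ObjectProperty.ι _).mapIso τ).commRingCatIsoToRingEquiv
  exact hpow x hx

end Main

end LiftingNumber

theorem corollary3p14 (p e : ℕ) (hp : p.Prime) (hpe : ¬ p ∣ e) (he : 1 < e) :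
    LiftingNumber.liftingNumber.{u} p e = (e : ℕ∞) + 1 := by
  have : Fact p.Prime := ⟨hp⟩
  apply le_antisymm
  · exact_mod_cast iInf₂_le (e + 1) (LiftingNumber.isLiftable_succ.{u} hpe he)
  · exact le_iInf₂ fun n hn => by exact_mod_cast hn.lt hpe he
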